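/- Let $\{w_n\}_{n\ge 1}$ be positive weights, let $\Omega_\delta=\{s\in\mathbb C:\operatorname{Re}s>\delta\}$, and let $\Delta,\Delta'$ be real numbers such that $\sum_{n\ge1}w_n^{-1}n^{-2\sigma}<\infty$ for every $\sigma>\Delta'$. Let $\mathcal H^{\mathbf w}$ be the Hilbert space of Dirichlet series $\sum_{n\ge1} a_nn^{-s}$ with $\sum_n|a_n|^2w_n<\infty$ and inner product $\langle\sum a_nn^{-s},\sum b_nn^{-s}\rangle=\sum_n a_n\overline{b_n}w_n$; its elements converge on $\Omega_{\Delta'}$ and are viewed as functions there. For $N\ge1$ let $\langle P_N\rangle$ be the set of all products of powers of the first $N$ primes, and let $\pi_N$ be the orthogonal projection of $\mathcal H^{\mathbf w}$ onto the closed span of $\{n^{-s}:n\in\langle P_N\rangle\}$. Let $\varphi$ be a multiplier of $\mathcal H^{\mathbf w}$, that is, a function defined on $\Omega_{\Delta'}$ such that $\varphi f\in\mathcal H^{\mathbf w}$ for every $f\in\mathcal H^{\mathbf w}$. Then on $\Omega_{\Delta'}$ the function $\varphi$ is the sum of a convergent Dirichlet series which belongs to $\mathcal H^{\mathbf w}$;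 so $\pi_N\varphi$ is defined. Wherever this series converges, its sum is again denoted by $\varphi$. Suppose that for some $B$ and every $N\ge1$ the Dirichlet series of $\pi_N\varphi$ converges on $\Omega_\Delta$ and its sum satisfies $|\pi_N\varphi(s)|\le B$ for all $s\in\Omega_\Delta$. Then: (i) some subsequence $\{\pi_{N_j}\varphi\}_{j}$ converges pointwise to $\varphi$ on $\Omega_\Delta$; (ii) the Dirichlet series of $\varphi$ converges at every point of $\Omega_\Delta$; (iii) $|\varphi|_{\Omega_\Delta}:=\sup_{s\in\Omega_\Delta}|\varphi(s)|\le B$. Moreover, the Dirichlet series of every $\pi_N\varphi$ $(N\ge 1)$ automatically converges on $\Omega_\Delta$ if $\sum_{n\in\langle P_N\rangle}w_n^{-1}n^{-2\sigma}<\infty$ for every $N\ge 1$ and every $\sigma>\Delta$. -/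

import Mathlib

open Filter Topology

namespace DirichletHilbert

/-- The open half-plane of complex numbers with real part larger than `δ`. -/
def Omega (δ : ℝ) : Set ℂ := {s | δ < s.re}

/-- The partial sum of the terms with index at most `M` of the Dirichlet series `∑ a n * n ^ (-s)`. -/
noncomputable def partialSum (a : ℕ+ → ℂ) (s : ℂ) (M : ℕ+) : ℂ :=
  ∑ n ∈ Finset.Icc 1 M, a n * ((n : ℕ) : ℂ) ^ (-s)

/-- The Dirichlet series with coefficients `a` converges (possibly conditionally) at `s`. -/
def Converges (a : ℕ+ → ℂ) (s : ℂ) : Prop :=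
  ∃ z : ℂ, Tendsto (partialSum a s) atTop (𝓝 z)

/-- The sum of the Dirichlet series with coefficients `a` at `s`; it is meaningful only
where the series converges. -/
noncomputable def seriesSum (a : ℕ+ → ℂ) (s : ℂ) : ℂ :=
  limUnder atTop (partialSum a s)

/-- A sequence of positive weights. -/
abbrev Weight : Type := ℕ+ → Set.Ioi (0 : ℝ)

/-- The sequences `a` with `∑ |a n| ^ 2 * w n < ∞`. -/
def coeffSpace (w : Weight) : Submodule ℂ (ℕ+ → ℂ) where
  carrier := {a | Summable fun n => ‖a n‖ ^ 2 * (w n : ℝ)}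
  zero_mem' := by simp [summable_zero]
  add_mem' := by
    intro a b ha hb
    refine Summable.of_nonneg_of_le
      (fun n => mul_nonneg (sq_nonneg _) (le_of_lt (w n).2)) (fun n => ?_)
      ((ha.mul_left 2).add (hb.mul_left 2))
    have hw : (0 : ℝ) < w n := (w n).2
    have h1 : ‖(a + b) n‖ ≤ ‖a n‖ + ‖b n‖ := norm_add_le _ _
    have h2 : ‖(a + b) n‖ ^ 2 ≤ 2 * ‖a n‖ ^ 2 + 2 * ‖b n‖ ^ 2 := by
      nlinarith [norm_nonneg ((a + b) n), sq_nonneg (‖a n‖ - ‖b n‖),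
        norm_nonneg (a n), norm_nonneg (b n)]
    calc ‖(a + b) n‖ ^ 2 * (w n : ℝ)
        ≤ (2 * ‖a n‖ ^ 2 + 2 * ‖b n‖ ^ 2) * (w n : ℝ) :=
          mul_le_mul_of_nonneg_right h2 hw.le
      _ = 2 * (‖a n‖ ^ 2 * (w n : ℝ)) + 2 * (‖b n‖ ^ 2 * (w n : ℝ)) := by ring
  smul_mem' := by
    intro c a ha
    have h := Summable.mul_left (‖c‖ ^ 2) ha
    refine h.congr (fun n => ?_)
    simp [mul_pow, mul_assoc]

/-- The weighted space of the Dirichlet series `∑ a n * n ^ (-s)` with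
`∑ |a n| ^ 2 * w n < ∞`; an element is recorded by its coefficient sequence. -/
def HSpace (w : Weight) : Type := coeffSpace w

noncomputable instance (w : Weight) : AddCommGroup (HSpace w) :=
  inferInstanceAs (AddCommGroup (coeffSpace w))

noncomputable instance (w : Weight) : Module ℂ (HSpace w) :=
  inferInstanceAs (Module ℂ (coeffSpace w))

/-- The coefficient sequence of an element of the weighted space. -/
def HSpace.coeff {w : Weight} (f : HSpace w) : ℕ+ → ℂ := f.1

/-- The linear bijection onto `ℓ²` that multiplies the `n`-th coefficient by `√(w n)`;
it serves only to set up the Hilbert space structure. -/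
noncomputable def toEll (w : Weight) : HSpace w →ₗ[ℂ] lp (fun _ : ℕ+ => ℂ) 2 where
  toFun f := ⟨fun n => ((Real.sqrt (w n) : ℝ) : ℂ) * f.coeff n, by
    refine memℓp_gen ?_
    refine Summable.congr f.2 (fun n => ?_)
    have hw : (0 : ℝ) ≤ w n := le_of_lt (w n).2
    simp [mul_pow, Real.sq_sqrt hw, abs_of_nonneg (Real.sqrt_nonneg _), HSpace.coeff, mul_comm]⟩
  map_add' f g := by
    ext n
    exact mul_add _ _ _
  map_smul' c f := by
    ext n
    exact mul_left_comm _ c _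

theorem toEll_apply (w : Weight) (f : HSpace w) (n : ℕ+) :
    toEll w f n = ((Real.sqrt (w n) : ℝ) : ℂ) * f.coeff n := rfl

theorem sqrt_weight_ne (w : Weight) (n : ℕ+) : ((Real.sqrt (w n) : ℝ) : ℂ) ≠ 0 :=
  Complex.ofReal_ne_zero.2 (Real.sqrt_pos.2 (w n).2).ne'

theorem toEll_injective (w : Weight) : Function.Injective (toEll w) := by
  intro f g h
  apply Subtype.ext
  funext n
  have h1 : toEll w f n = toEll w g n := by rw [h]
  rw [toEll_apply, toEll_apply] at h1
  exact mul_left_cancel₀ (sqrt_weight_ne w n) h1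

theorem toEll_surjective (w : Weight) : Function.Surjective (toEll w) := by
  intro b
  have hb : Summable fun n => ‖b n‖ ^ 2 := by
    have h := (lp.memℓp b).summable (by simp)
    simpa using h
  refine ⟨⟨fun n => b n / ((Real.sqrt (w n) : ℝ) : ℂ), ?_⟩, ?_⟩
  · refine Summable.congr hb (fun n => ?_)
    have hw : (0 : ℝ) < w n := (w n).2
    rw [norm_div, Complex.norm_real, Real.norm_of_nonneg (Real.sqrt_nonneg _), div_pow,
      Real.sq_sqrt hw.le, div_mul_cancel₀ _ hw.ne']
  · ext n
    exact mul_div_cancel₀ _ (sqrt_weight_ne w n)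

/-- The inner product `∑ conj (a n) * b n * w n`, linear in the second argument. -/
noncomputable instance (w : Weight) : Inner ℂ (HSpace w) where
  inner f g := ∑' n, (starRingEnd ℂ) (f.coeff n) * g.coeff n * ((w n : ℝ) : ℂ)

theorem inner_eq (w : Weight) (f g : HSpace w) :
    inner ℂ f g = inner ℂ (toEll w f) (toEll w g) := by
  rw [lp.inner_eq_tsum]
  refine tsum_congr (fun n => ?_)
  have hw : (0 : ℝ) ≤ w n := le_of_lt (w n).2
  have h : ((w n : ℝ) : ℂ) = ((Real.sqrt (w n) : ℝ) : ℂ) * ((Real.sqrt (w n) : ℝ) : ℂ) := by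
    rw [← Complex.ofReal_mul, Real.mul_self_sqrt hw]
  rw [toEll_apply, toEll_apply, h, RCLike.inner_apply, map_mul, Complex.conj_ofReal]
  ring

@[reducible]
noncomputable def innerCore (w : Weight) : InnerProductSpace.Core ℂ (HSpace w) where
  inner := inner ℂ
  conj_inner_symm f g := by
    simp only [inner_eq]
    exact inner_conj_symm _ _
  re_inner_nonneg f := by
    simp only [inner_eq]
    exact inner_self_nonneg
  add_left f g h := by
    simp only [inner_eq, map_add]
    exact inner_add_left _ _ _
  smul_left f g c := by
    simp only [inner_eq, map_smul]
    exact inner_smul_left _ _ _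
  definite f hf := by
    simp only [inner_eq] at hf
    exact toEll_injective w ((inner_self_eq_zero.1 hf).trans (map_zero _).symm)

noncomputable instance (w : Weight) : NormedAddCommGroup (HSpace w) :=
  (innerCore w).toNormedAddCommGroup

noncomputable instance (w : Weight) : InnerProductSpace ℂ (HSpace w) :=
  InnerProductSpace.ofCore (innerCore w).toCore

theorem norm_toEll (w : Weight) (f : HSpace w) : ‖toEll w f‖ = ‖f‖ := by
  have h1 : ‖toEll w f‖ ^ 2 = RCLike.re (inner ℂ (toEll w f) (toEll w f)) :=
    (inner_self_eq_norm_sq (𝕜 := ℂ) _).symm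
  have h2 : ‖f‖ ^ 2 = RCLike.re (inner ℂ f f) :=
    (inner_self_eq_norm_sq (𝕜 := ℂ) _).symm
  rw [← inner_eq] at h1
  exact (sq_eq_sq₀ (norm_nonneg _) (norm_nonneg _)).1 (h1.trans h2.symm)

instance (w : Weight) : CompleteSpace (HSpace w) := by
  let e : HSpace w ≃ₗᵢ[ℂ] lp (fun _ : ℕ+ => ℂ) 2 :=
    { LinearEquiv.ofBijective (toEll w) ⟨toEll_injective w, toEll_surjective w⟩ with
      norm_map' := norm_toEll w }
  exact (completeSpace_congr (e := e.toEquiv) e.isometry.isUniformEmbedding).2 inferInstance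

/-- The Dirichlet series `n ^ (-s)`, consisting of a single term. -/
noncomputable def monomial (w : Weight) (n : ℕ+) : HSpace w :=
  ⟨Pi.single n 1, by
    refine summable_of_ne_finset_zero (s := {n}) (fun m hm => ?_)
    have : m ≠ n := by simpa using hm
    simp [this]⟩

/-- The words generated by the first `N` primes: all products of powers of these primes. -/
def words (N : ℕ) : Submonoid ℕ+ :=
  Submonoid.closure {p | ∃ i < N, (p : ℕ) = Nat.nth Nat.Prime i}

/-- The closed span of the `n ^ (-s)` with `n` a word in the first `N` primes. -/
noncomputable def HSub (w : Weight) (N : ℕ) : Submodule ℂ (HSpace w) :=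
  (Submodule.span ℂ (monomial w '' (words N : Set ℕ+))).topologicalClosure

instance (w : Weight) (N : ℕ) : CompleteSpace (HSub w N) :=
  (Submodule.isClosed_topologicalClosure _).completeSpace_coe

/-- The orthogonal projection onto `HSub w N`. -/
noncomputable def proj (w : Weight) (N : ℕ) : HSpace w →L[ℂ] HSpace w :=
  (HSub w N).starProjection

/-- `φ` is a multiplier of the weighted space, whose elements are viewed as functions on
`Omega σ₀`: for every `f` in the space, `φ * f` is again in the space. Only the values of `φ`
on `Omega σ₀` matter. -/
def IsMultiplier (w : Weight) (σ₀ : ℝ) (φ : ℂ → ℂ) : Prop :=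
  ∀ f : HSpace w, ∃ g : HSpace w, ∀ s ∈ Omega σ₀,
    seriesSum g.coeff s = φ s * seriesSum f.coeff s

theorem seriesSum_one (w : Weight) (s : ℂ) : seriesSum (monomial w 1).coeff s = 1 := by
  refine Tendsto.limUnder_eq (tendsto_const_nhds.congr (fun M => ?_))
  unfold partialSum
  rw [Finset.sum_eq_single 1]
  · simp [monomial, HSpace.coeff]
  · intro b _ hb
    simp [monomial, HSpace.coeff, hb]
  · intro h
    exact absurd (Finset.mem_Icc.2 ⟨le_rfl, one_le⟩) h

theorem IsMultiplier.exists_rep {w : Weight} {σ₀ : ℝ} {φ : ℂ → ℂ} (hφ : IsMultiplier w σ₀ φ) :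
    ∃ f : HSpace w, ∀ s ∈ Omega σ₀, seriesSum f.coeff s = φ s := by
  obtain ⟨g, hg⟩ := hφ (monomial w 1)
  exact ⟨g, fun s hs => by rw [hg s hs, seriesSum_one, mul_one]⟩

/-- A multiplier, regarded as an element of the weighted space: the element whose Dirichlet
series represents it on `Omega σ₀`. The element is unique once the weights make all series
in the space converge on `Omega σ₀`. -/
noncomputable def IsMultiplier.series {w : Weight} {σ₀ : ℝ} {φ : ℂ → ℂ}
    (hφ : IsMultiplier w σ₀ φ) : HSpace w :=
  hφ.exists_rep.choose

theorem IsMultiplier.seriesSum_series {w : Weight} {σ₀ : ℝ} {φ : ℂ → ℂ}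
    (hφ : IsMultiplier w σ₀ φ) {s : ℂ} (hs : s ∈ Omega σ₀) :
    seriesSum hφ.series.coeff s = φ s :=
  hφ.exists_rep.choose_spec s hs

end DirichletHilbert

namespace DirichletHilbert

open MeasureTheory

/-! The core is a quantitative Bohr theorem. If a Dirichlet series, absolutely convergent far to the
right, has a sum bounded by `B` on `Omega δ`, its `m`-th partial sums there are at most `B * C * m ^
θ`, with `θ > 0` arbitrarily small and `C` depending on `θ` only (`norm_rangeSum_le_mul_truncNorm`,
`exists_truncNorm_le`). Indeed the `m`-th partial sum is an average of vertical translates of the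
sum against a kernel whose Fourier transform is 1 on `[0, log m]` and 0 beyond `log (m + 1)`.

Applied to all projections, the bound is uniform in `N`. A fixed partial sum of the multiplier's
series equals that of its projection for large `N`, so it obeys the same bound. Summation by parts
(`tendsto_rangeSum_add`) then gives convergence slightly to the right, hence on all of `Omega Δ`,
and dominated convergence of the summed-by-parts series shows that the whole sequence of projections
converges to the sum (`tendsto_seriesSum_proj`). The bound `B` passes to the limit. -/

/-! ### Summation by parts. -/

/-- The sum of the first `m` terms of the Dirichlet series `∑ c i * (i + 1) ^ (-s)`. -/
noncomputable def rangeSum (c : ℕ → ℂ) (s : ℂ) (m : ℕ) : ℂ :=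
  ∑ i ∈ Finset.range m, c i * ((i + 1 : ℕ) : ℂ) ^ (-s)

/-- The `i`-th term that summation by parts produces from `∑ c i * (i + 1) ^ (-(s₀ + u))`. -/
noncomputable def abelTerm (c : ℕ → ℂ) (s₀ u : ℂ) (i : ℕ) : ℂ :=
  rangeSum c s₀ (i + 1) * (((i + 1 : ℕ) : ℂ) ^ (-u) - ((i + 2 : ℕ) : ℂ) ^ (-u))

theorem rangeSum_add_eq (c : ℕ → ℂ) (s₀ u : ℂ) (m : ℕ) :
    rangeSum c (s₀ + u) m = rangeSum c s₀ m * ((m + 1 : ℕ) : ℂ) ^ (-u)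
      + ∑ i ∈ Finset.range m, abelTerm c s₀ u i := by
  induction m with
  | zero => simp [rangeSum]
  | succ m ih =>
    have h1 : rangeSum c (s₀ + u) (m + 1) = rangeSum c (s₀ + u) m
        + c m * ((m + 1 : ℕ) : ℂ) ^ (-s₀) * ((m + 1 : ℕ) : ℂ) ^ (-u) := by
      rw [rangeSum, Finset.sum_range_succ, ← rangeSum, neg_add,
        Complex.cpow_add _ _ (Nat.cast_ne_zero.2 m.succ_ne_zero), mul_assoc]
    have h2 : rangeSum c s₀ (m + 1) = rangeSum c s₀ m + c m * ((m + 1 : ℕ) : ℂ) ^ (-s₀) := by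
      rw [rangeSum, Finset.sum_range_succ, ← rangeSum]
    rw [h1, ih, Finset.sum_range_succ, abelTerm, h2]
    ring

/-- Mean value inequality on `[i + 1, i + 2]`: the derivative of `x ^ (-u)` has its largest modulus
at the left end. -/
theorem norm_cpow_sub_cpow_succ_le {u : ℂ} (hu : 0 < u.re) (i : ℕ) :
    ‖((i + 1 : ℕ) : ℂ) ^ (-u) - ((i + 2 : ℕ) : ℂ) ^ (-u)‖
      ≤ ‖u‖ * ((i + 1 : ℕ) : ℝ) ^ (-u.re - 1) := by
  have hu0 : -u ≠ 0 := by
    intro h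
    simp [neg_eq_zero.1 h] at hu
  have key := norm_image_sub_le_of_norm_deriv_le_segment'
    (f := fun x : ℝ => (x : ℂ) ^ (-u)) (f' := fun x : ℝ => -u * (x : ℂ) ^ (-u - 1))
    (a := ((i + 1 : ℕ) : ℝ)) (b := ((i + 2 : ℕ) : ℝ))
    (C := ‖u‖ * ((i + 1 : ℕ) : ℝ) ^ (-u.re - 1)) ?_ ?_ ((i + 2 : ℕ) : ℝ)
    ⟨by push_cast; linarith, le_rfl⟩
  · rw [norm_sub_rev]
    refine (le_of_eq ?_).trans (key.trans (le_of_eq ?_))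
    · simp
    · push_cast; ring
  · intro x hx
    have hx0 : x ≠ 0 := by
      have h : ((i + 1 : ℕ) : ℝ) ≤ x := hx.1
      push_cast at h
      have : (0 : ℝ) ≤ i := i.cast_nonneg
      linarith
    exact (hasDerivAt_ofReal_cpow_const hx0 hu0).hasDerivWithinAt
  · intro x hx
    have hi : (0 : ℝ) < ((i + 1 : ℕ) : ℝ) := by positivity
    have hx0 : 0 < x := hi.trans_le hx.1
    rw [norm_mul, norm_neg, Complex.norm_cpow_eq_rpow_re_of_pos hx0]
    refine mul_le_mul_of_nonneg_left ?_ (norm_nonneg _)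
    simp only [Complex.sub_re, Complex.neg_re, Complex.one_re]
    exact Real.rpow_le_rpow_of_nonpos hi hx.1 (by linarith)

/-- The majorant sees the coefficients only through `K` and is summable when `ε < u.re`; this
uniformity drives both the Weierstrass test and the dominated convergence below. -/
theorem norm_abelTerm_le {c : ℕ → ℂ} {s₀ u : ℂ} {K ε : ℝ}
    (hK : ∀ i : ℕ, ‖rangeSum c s₀ (i + 1)‖ ≤ K * ((i + 1 : ℕ) : ℝ) ^ ε)
    (hu : 0 < u.re) (i : ℕ) :
    ‖abelTerm c s₀ u i‖ ≤ K * ‖u‖ * ((i + 1 : ℕ) : ℝ) ^ (ε - u.re - 1) := by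
  have hi : (0 : ℝ) < ((i + 1 : ℕ) : ℝ) := by positivity
  rw [abelTerm, norm_mul]
  refine (mul_le_mul (hK i) (norm_cpow_sub_cpow_succ_le hu i) (norm_nonneg _)
    ((norm_nonneg _).trans (hK i))).trans (le_of_eq ?_)
  rw [show ε - u.re - 1 = ε + (-u.re - 1) by ring, Real.rpow_add hi]
  ring

theorem summable_succ_rpow {p : ℝ} (hp : p < -1) :
    Summable fun i : ℕ => ((i + 1 : ℕ) : ℝ) ^ p :=
  (summable_nat_add_iff (f := fun i : ℕ => (i : ℝ) ^ p) 1).2 (Real.summable_nat_rpow.2 hp)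

theorem summable_abelTerm {c : ℕ → ℂ} {s₀ u : ℂ} {K ε : ℝ} (hε : 0 ≤ ε)
    (hK : ∀ i : ℕ, ‖rangeSum c s₀ (i + 1)‖ ≤ K * ((i + 1 : ℕ) : ℝ) ^ ε)
    (hu : ε < u.re) : Summable (abelTerm c s₀ u) :=
  Summable.of_norm_bounded ((summable_succ_rpow (by linarith)).mul_left (K * ‖u‖))
    (norm_abelTerm_le hK (hε.trans_lt hu))

/-- Summation by parts: if the partial sums at `s₀` grow at most like `m ^ ε`, the series
converges at `s₀ + u` as soon as `ε < u.re`. -/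
theorem tendsto_rangeSum_add {c : ℕ → ℂ} {s₀ u : ℂ} {K ε : ℝ} (hε : 0 ≤ ε)
    (hK : ∀ i : ℕ, ‖rangeSum c s₀ (i + 1)‖ ≤ K * ((i + 1 : ℕ) : ℝ) ^ ε)
    (hu : ε < u.re) :
    Tendsto (rangeSum c (s₀ + u)) atTop (𝓝 (∑' i, abelTerm c s₀ u i)) := by
  have h1 : Tendsto (fun m : ℕ => rangeSum c s₀ m * ((m + 1 : ℕ) : ℂ) ^ (-u)) atTop (𝓝 0) := by
    have h2 : Tendsto (fun m : ℕ => K * ((m + 1 : ℕ) : ℝ) ^ (-(u.re - ε))) atTop (𝓝 0) := by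
      have h3 := (tendsto_rpow_neg_atTop (sub_pos.2 hu)).comp
        ((tendsto_natCast_atTop_atTop (R := ℝ)).comp (tendsto_add_atTop_nat 1))
      simpa using h3.const_mul K
    refine squeeze_zero_norm (fun m => ?_) h2
    have hm : (0 : ℝ) < ((m + 1 : ℕ) : ℝ) := by positivity
    have hK0 : 0 ≤ K := by simpa using (norm_nonneg _).trans (hK 0)
    have h4 : ‖rangeSum c s₀ m‖ ≤ K * ((m + 1 : ℕ) : ℝ) ^ ε := by
      cases m with
      | zero => simpa [rangeSum] using hK0
      | succ m =>
        refine (hK m).trans (mul_le_mul_of_nonneg_left ?_ hK0)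
        exact Real.rpow_le_rpow (by positivity) (by push_cast; linarith) hε
    rw [norm_mul, Complex.norm_natCast_cpow_of_pos m.succ_pos]
    refine (mul_le_mul_of_nonneg_right h4 (by positivity)).trans (le_of_eq ?_)
    rw [mul_assoc, ← Real.rpow_add hm, Complex.neg_re]
    congr 2
    ring
  have h5 := (summable_abelTerm hε hK hu).hasSum.tendsto_sum_nat
  have h6 := h1.add h5
  rw [zero_add] at h6
  exact h6.congr (fun m => (rangeSum_add_eq c s₀ u m).symm)

theorem exists_norm_rangeSum_le {c : ℕ → ℂ} {s : ℂ} {z : ℂ}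
    (h : Tendsto (rangeSum c s) atTop (𝓝 z)) : ∃ K : ℝ, ∀ m, ‖rangeSum c s m‖ ≤ K := by
  obtain ⟨K, hK⟩ := (Metric.isBounded_range_of_tendsto _ h).exists_norm_le
  exact ⟨K, fun m => hK _ ⟨m, rfl⟩⟩

/-! ### Holomorphy of the sum of a Dirichlet series. -/

theorem isOpen_Omega (δ : ℝ) : IsOpen (Omega δ) := isOpen_lt continuous_const Complex.continuous_re

/-- The sum of a Dirichlet series that converges on a half-plane is holomorphic there. -/
theorem differentiableOn_of_tendsto_rangeSum {c : ℕ → ℂ} {F : ℂ → ℂ} {δ : ℝ}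
    (hF : ∀ s ∈ Omega δ, Tendsto (rangeSum c s) atTop (𝓝 (F s))) :
    DifferentiableOn ℂ F (Omega δ) := by
  intro s hs
  have hs' : δ < s.re := hs
  -- The base point `s₀ = s - 2η` stays in `Omega δ`, while points `z` near `s` satisfy `(z - s₀).re
  -- > η`. The radius `2 * η + 1` below only serves to bound `‖z - s₀‖`.
  set η := (s.re - δ) / 4 with hη
  have hη0 : 0 < η := by rw [hη]; linarith
  set s₀ : ℂ := s - ((2 * η : ℝ) : ℂ) with hs₀
  have hs₀re : s₀.re = s.re - 2 * η := by rw [hs₀, Complex.sub_re, Complex.ofReal_re]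
  obtain ⟨K, hK⟩ := exists_norm_rangeSum_le (hF s₀ (by
    change δ < s₀.re
    rw [hs₀re]; linarith))
  have hK0 : 0 ≤ K := (norm_nonneg _).trans (hK 0)
  have hK' : ∀ i : ℕ, ‖rangeSum c s₀ (i + 1)‖ ≤ K * ((i + 1 : ℕ) : ℝ) ^ (0 : ℝ) := fun i => by
    simpa using hK (i + 1)
  set U : Set ℂ := Omega (s₀.re + η) ∩ Metric.ball s₀ (2 * η + 1) with hU
  have hUo : IsOpen U := (isOpen_Omega _).inter Metric.isOpen_ball
  have hsU : s ∈ U := by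
    refine ⟨?_, ?_⟩
    · change s₀.re + η < s.re
      rw [hs₀re]; linarith
    · rw [Metric.mem_ball, dist_eq_norm, hs₀, sub_sub_cancel, Complex.norm_real,
        Real.norm_of_nonneg (by linarith)]
      linarith
  have hd : DifferentiableOn ℂ (fun z => ∑' i, abelTerm c s₀ (z - s₀) i) U := by
    refine Complex.differentiableOn_tsum_of_summable_norm
      (u := fun i : ℕ => K * (2 * η + 1) * ((i + 1 : ℕ) : ℝ) ^ (-η - 1))
      ((summable_succ_rpow (by linarith)).mul_left _) (fun i => ?_) hUo (fun i z hz => ?_)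
    · have h1 : ((i + 1 : ℕ) : ℂ) ≠ 0 := Nat.cast_ne_zero.2 (by omega)
      have h2 : ((i + 2 : ℕ) : ℂ) ≠ 0 := Nat.cast_ne_zero.2 (by omega)
      unfold abelTerm
      refine Differentiable.differentiableOn ?_
      refine (Differentiable.sub ?_ ?_).const_mul _
      · exact ((differentiable_id.sub_const _).neg).const_cpow (Or.inl h1)
      · exact ((differentiable_id.sub_const _).neg).const_cpow (Or.inl h2)
    · have hz1 : s₀.re + η < z.re := hz.1
      have hz2 : ‖z - s₀‖ < 2 * η + 1 := by simpa [dist_eq_norm] using hz.2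
      have hre : η < (z - s₀).re := by rw [Complex.sub_re]; linarith
      refine (norm_abelTerm_le hK' (hη0.trans hre) i).trans ?_
      refine mul_le_mul (mul_le_mul_of_nonneg_left hz2.le hK0) ?_ (by positivity) (by positivity)
      exact Real.rpow_le_rpow_of_exponent_le (by push_cast; linarith [i.cast_nonneg (α := ℝ)])
        (by linarith)
  refine ((hd.differentiableAt (hUo.mem_nhds hsU)).congr_of_eventuallyEq ?_).differentiableWithinAt
  filter_upwards [hUo.mem_nhds hsU] with z hz
  have hz1 : s₀.re + η < z.re := hz.1
  have hre : 0 < (z - s₀).re := by rw [Complex.sub_re]; linarith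
  have h := tendsto_rangeSum_add le_rfl hK' hre
  rw [add_sub_cancel] at h
  refine tendsto_nhds_unique (hF z ?_) h
  change δ < z.re
  linarith

/-! ### A kernel with trapezoidal Fourier transform. -/

/-- The function `(1 - cos (x * t)) / t ^ 2`. -/
noncomputable def fejer (x t : ℝ) : ℝ := (1 - Real.cos (x * t)) / t ^ 2

theorem fejer_nonneg (x t : ℝ) : 0 ≤ fejer x t :=
  div_nonneg (by linarith [Real.cos_le_one (x * t)]) (sq_nonneg t)

theorem measurable_fejer (x : ℝ) : Measurable (fejer x) := by
  unfold fejer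
  fun_prop

theorem integrable_fejer_one : Integrable (fejer 1) := by
  -- The constant comes from `1 - cos t ≤ t ^ 2 / 2` and `1 - cos t ≤ 2`, which give `(1 - cos t) *
  -- (1 + t ^ 2) ≤ (1 / 2 + 2) * t ^ 2`.
  refine (integrable_inv_one_add_sq.const_mul (5 / 2)).mono'
    (measurable_fejer 1).aestronglyMeasurable (ae_of_all _ fun t => ?_)
  rw [Real.norm_of_nonneg (fejer_nonneg 1 t), fejer, one_mul]
  rcases eq_or_ne t 0 with rfl | ht
  · norm_num
  · have ht2 : 0 < t ^ 2 := by positivity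
    rw [← div_eq_mul_inv, div_le_div_iff₀ ht2 (by positivity)]
    nlinarith [Real.one_sub_sq_div_two_le_cos (x := t), Real.neg_one_le_cos t]

theorem fejer_eq (x t : ℝ) : fejer x t = x ^ 2 * fejer 1 (x * t) := by
  unfold fejer
  rcases eq_or_ne x 0 with rfl | hx
  · simp
  · rw [one_mul, mul_pow, ← mul_div_assoc, mul_div_mul_left _ _ (pow_ne_zero 2 hx)]

theorem integrable_fejer (x : ℝ) : Integrable (fejer x) := by
  rw [funext (fejer_eq x)]
  rcases eq_or_ne x 0 with rfl | hx
  · simp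
  · exact (integrable_fejer_one.comp_mul_left' hx).const_mul _

/-- The integral of `(1 - cos t) / t ^ 2` over the real line. -/
noncomputable def fejerConst : ℝ := ∫ t, fejer 1 t

/-- Scaling reduces everything to `x = 1`. The value of `fejerConst` is never needed, only its
positivity. -/
theorem integral_fejer (x : ℝ) : ∫ t, fejer x t = fejerConst * |x| := by
  rw [funext (fejer_eq x), integral_const_mul, Measure.integral_comp_mul_left, ← fejerConst,
    smul_eq_mul, abs_inv, ← sq_abs]
  rcases eq_or_ne x 0 with rfl | hx
  · simp
  · field_simp

theorem fejerConst_pos : 0 < fejerConst := by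
  rw [fejerConst, integral_pos_iff_support_of_nonneg (fejer_nonneg 1) integrable_fejer_one]
  refine lt_of_lt_of_le (b := volume (Set.Ioo (0 : ℝ) 1)) (by simp) (measure_mono fun t ht => ?_)
  have h1 : Real.cos t < 1 := by
    have := Real.cos_lt_cos_of_nonneg_of_le_pi le_rfl
      (by linarith [ht.2, Real.pi_gt_three] : t ≤ Real.pi) ht.1
    rwa [Real.cos_zero] at this
  have h2 : 0 < t := ht.1
  rw [Function.mem_support, fejer, one_mul]
  exact (div_pos (by linarith) (by positivity)).ne'

/-- A kernel on the real line whose Fourier transform is a trapezoid: equal to one on `[-a, a]`,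
to zero outside `[-A, A]`, and linear in between. -/
noncomputable def trapKernel (a A t : ℝ) : ℝ :=
  (fejerConst * (A - a))⁻¹ * ((Real.cos (a * t) - Real.cos (A * t)) / t ^ 2)

theorem trapKernel_eq (a A t : ℝ) :
    trapKernel a A t = (fejerConst * (A - a))⁻¹ * (fejer A t - fejer a t) := by
  unfold trapKernel fejer
  ring

theorem integrable_trapKernel (a A : ℝ) : Integrable (trapKernel a A) := by
  rw [funext (trapKernel_eq a A)]
  exact ((integrable_fejer A).sub (integrable_fejer a)).const_mul _

theorem trapKernel_neg (a A t : ℝ) : trapKernel a A (-t) = trapKernel a A t := by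
  simp [trapKernel]

/-- Product-to-sum formulas turn the integrand into four `fejer` functions, the constants 1
cancelling. -/
theorem integral_cos_mul_trapKernel (a A x : ℝ) :
    ∫ t, Real.cos (x * t) * trapKernel a A t
      = (A - a)⁻¹ * ((|x + A| + |x - A| - |x + a| - |x - a|) / 2) := by
  have h : ∀ t, Real.cos (x * t) * trapKernel a A t = (fejerConst * (A - a))⁻¹ / 2 *
      (fejer (x + A) t + fejer (x - A) t - fejer (x + a) t - fejer (x - a) t) := by
    intro t
    unfold trapKernel fejer
    rw [add_mul, sub_mul, add_mul, sub_mul, Real.cos_add, Real.cos_sub, Real.cos_add, Real.cos_sub]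
    ring
  have i1 := integrable_fejer (x + A)
  have i2 := integrable_fejer (x - A)
  have i3 := integrable_fejer (x + a)
  have i4 := integrable_fejer (x - a)
  have h12 : Integrable fun t => fejer (x + A) t + fejer (x - A) t := i1.add i2
  have h123 : Integrable fun t => fejer (x + A) t + fejer (x - A) t - fejer (x + a) t := h12.sub i3
  rw [funext h, integral_const_mul, integral_sub h123 i4, integral_sub h12 i3, integral_add i1 i2]
  simp only [integral_fejer]
  have := fejerConst_pos.ne'
  rw [mul_inv]
  field_simp

theorem integral_cos_mul_trapKernel_of_le {a A x : ℝ} (h : a < A) (hx : 0 ≤ x) (hxa : x ≤ a) :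
    ∫ t, Real.cos (x * t) * trapKernel a A t = 1 := by
  rw [integral_cos_mul_trapKernel, abs_of_nonneg (by linarith : 0 ≤ x + A),
    abs_of_nonpos (by linarith : x - A ≤ 0), abs_of_nonneg (by linarith : 0 ≤ x + a),
    abs_of_nonpos (by linarith : x - a ≤ 0)]
  have : A - a ≠ 0 := by linarith
  field_simp
  ring

theorem integral_cos_mul_trapKernel_of_ge {a A x : ℝ} (ha : 0 ≤ a) (h : a < A) (hx : A ≤ x) :
    ∫ t, Real.cos (x * t) * trapKernel a A t = 0 := by
  rw [integral_cos_mul_trapKernel, abs_of_nonneg (by linarith : 0 ≤ x + A),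
    abs_of_nonneg (by linarith : 0 ≤ x - A), abs_of_nonneg (by linarith : 0 ≤ x + a),
    abs_of_nonneg (by linarith : 0 ≤ x - a)]
  ring

/-- The kernel is even, so averaging over `t` and `-t` replaces the exponential by a cosine. -/
theorem integral_cexp_mul_trapKernel (a A x : ℝ) :
    ∫ t : ℝ, Complex.exp (-(x * t * Complex.I)) * (trapKernel a A t : ℂ)
      = ((∫ t, Real.cos (x * t) * trapKernel a A t : ℝ) : ℂ) := by
  have hint : ∀ y : ℝ, Integrable fun t : ℝ =>
      Complex.exp (-(y * t * Complex.I)) * (trapKernel a A t : ℂ) := by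
    intro y
    refine ((integrable_trapKernel a A).ofReal (𝕜 := ℂ)).bdd_mul (c := 1)
      (Continuous.aestronglyMeasurable (by fun_prop)) (ae_of_all _ fun t => ?_)
    rw [show -((y : ℂ) * t * Complex.I) = ((-(y * t) : ℝ) : ℂ) * Complex.I by push_cast; ring,
      Complex.norm_exp_ofReal_mul_I]
  have h1 : ∫ t : ℝ, Complex.exp (-(x * t * Complex.I)) * (trapKernel a A t : ℂ)
      = ∫ t : ℝ, Complex.exp (-((-x : ℝ) * t * Complex.I)) * (trapKernel a A t : ℂ) := by
    rw [← integral_neg_eq_self]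
    refine integral_congr_ae (ae_of_all _ fun t => ?_)
    simp only [trapKernel_neg]
    push_cast
    ring_nf
  have h2 : (2 : ℂ) * ∫ t : ℝ, Complex.exp (-(x * t * Complex.I)) * (trapKernel a A t : ℂ)
      = 2 * ((∫ t, Real.cos (x * t) * trapKernel a A t : ℝ) : ℂ) := by
    rw [two_mul]
    nth_rewrite 2 [h1]
    rw [← integral_add (hint x) (hint (-x)), ← integral_complex_ofReal, ← integral_const_mul]
    refine integral_congr_ae (ae_of_all _ fun t => ?_)
    simp only [Complex.ofReal_mul, Complex.ofReal_cos, Complex.cos, Complex.ofReal_neg]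
    ring_nf
  exact mul_left_cancel₀ two_ne_zero h2

/-! ### Growth of the truncation kernel's norm. -/

/-- The `L¹` norm of the kernel that truncates a Dirichlet series after the `m`-th term. -/
noncomputable def truncNorm (m : ℕ) : ℝ :=
  ∫ t, ‖trapKernel (Real.log m) (Real.log (m + 1)) t‖

theorem abs_cos_sub_cos_le_sq {a A : ℝ} (ha : 0 ≤ a) (h : a < A) (t : ℝ) :
    |Real.cos (a * t) - Real.cos (A * t)| ≤ (A - a) * A * t ^ 2 := by
  have hs : ∀ {y : ℝ}, 0 ≤ y → |Real.sin (y * t)| ≤ y * |t| := fun {y} hy => by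
    have := Real.abs_sin_le_abs (x := y * t)
    rwa [abs_mul, abs_of_nonneg hy] at this
  have h1 := hs (y := (A + a) / 2) (by linarith)
  have h2 := hs (y := (A - a) / 2) (by linarith)
  have e : Real.cos (a * t) - Real.cos (A * t)
      = 2 * Real.sin ((A + a) / 2 * t) * Real.sin ((A - a) / 2 * t) := by
    rw [Real.cos_sub_cos, show (a * t + A * t) / 2 = (A + a) / 2 * t by ring,
      show (a * t - A * t) / 2 = -((A - a) / 2 * t) by ring, Real.sin_neg]
    ring
  rw [e, abs_mul, abs_mul, abs_two, mul_assoc]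
  have h3 := mul_le_mul h1 h2 (abs_nonneg _) (mul_nonneg (by linarith) (abs_nonneg t))
  have h4 : (A + a) / 2 * |t| * ((A - a) / 2 * |t|) = (A + a) / 2 * ((A - a) / 2) * t ^ 2 := by
    rw [← sq_abs t]; ring
  rw [h4] at h3
  nlinarith [mul_nonneg (mul_nonneg (sub_pos.2 h).le (sub_pos.2 h).le) (sq_nonneg t)]

/-- Interpolation between the Lipschitz bound `(A - a) * |t|` and the trivial bound 2. -/
theorem abs_cos_sub_cos_le_rpow {a A θ : ℝ} (h : a < A) (hθ : 0 < θ) (hθ1 : θ ≤ 1) {t : ℝ}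
    (ht : t ≠ 0) : |Real.cos (a * t) - Real.cos (A * t)| ≤ 2 * ((A - a) * |t|) ^ (1 - θ) := by
  have hy : 0 < (A - a) * |t| := mul_pos (sub_pos.2 h) (abs_pos.2 ht)
  rcases le_total ((A - a) * |t|) 1 with h1 | h1
  · have h2 := Real.abs_cos_sub_cos_le (a * t) (A * t)
    rw [← sub_mul, abs_mul, abs_sub_comm a A, abs_of_pos (sub_pos.2 h)] at h2
    have h3 : (A - a) * |t| ≤ ((A - a) * |t|) ^ (1 - θ) := by
      simpa using Real.rpow_le_rpow_of_exponent_ge hy h1 (by linarith : 1 - θ ≤ 1)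
    linarith
  · have h2 := Real.one_le_rpow h1 (by linarith : 0 ≤ 1 - θ)
    have h3 : |Real.cos (a * t) - Real.cos (A * t)| ≤ 2 := by
      rw [abs_le]
      constructor <;> linarith [Real.cos_le_one (a * t), Real.cos_le_one (A * t),
        Real.neg_one_le_cos (a * t), Real.neg_one_le_cos (A * t)]
    linarith

/-- The quadratic bound handles `|t| ≤ 1` and the interpolated one `|t| ≥ 1`. A factor `A - a`
cancels the normalisation, at the cost of `(A - a) ^ (-θ)` for large `t`, where the decay stays
integrable. -/
theorem abs_trapKernel_le {a A θ t : ℝ} (ha : 0 ≤ a) (h : a < A) (hθ : 0 < θ) (hθ1 : θ ≤ 1) :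
    |trapKernel a A t| ≤ fejerConst⁻¹ * 4 * (A + 2 * (A - a) ^ (-θ)) * (1 + |t|) ^ (-(1 + θ)) := by
  have hc := fejerConst_pos
  have hh : 0 < A - a := sub_pos.2 h
  have hp : 0 ≤ (A - a) ^ (-θ) := (Real.rpow_pos_of_pos hh _).le
  rcases eq_or_ne t 0 with rfl | ht
  · simp [trapKernel]
    have : 0 ≤ A := by linarith
    positivity
  have ht0 : 0 < |t| := abs_pos.2 ht
  have key : |Real.cos (a * t) - Real.cos (A * t)| / t ^ 2 ≤
      (A - a) * (4 * (A + 2 * (A - a) ^ (-θ)) * (1 + |t|) ^ (-(1 + θ))) := by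
    have ht2 : t ^ 2 = |t| ^ 2 := (sq_abs t).symm
    rw [div_le_iff₀ (by positivity)]
    -- Absorbs the loss from `1 + |t| ≤ 2` when `|t| ≤ 1`, and from `1 + |t| ≤ 2 * |t|` when `|t| ≥
    -- 1`.
    have h4 : (4 : ℝ)⁻¹ ≤ 2 ^ (-(1 + θ)) := by
      rw [show (4 : ℝ)⁻¹ = 2 ^ (-2 : ℝ) by rw [Real.rpow_neg (by norm_num)]; norm_num]
      exact Real.rpow_le_rpow_of_exponent_le (by norm_num) (by linarith)
    have hA : 0 ≤ A := by linarith
    rcases le_total |t| 1 with h1 | h1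
    · have h2 : (2 : ℝ) ^ (-(1 + θ)) ≤ (1 + |t|) ^ (-(1 + θ)) :=
        Real.rpow_le_rpow_of_nonpos (by positivity) (by linarith) (by linarith)
      calc |Real.cos (a * t) - Real.cos (A * t)| ≤ (A - a) * (4 * A * 4⁻¹) * t ^ 2 := by
            refine (abs_cos_sub_cos_le_sq ha h t).trans (le_of_eq ?_)
            ring
        _ ≤ _ := by
            gcongr
            · linarith
            · exact h4.trans h2
    · have h2 : |t| ^ (-(1 + θ)) * 4⁻¹ ≤ (1 + |t|) ^ (-(1 + θ)) := by
        calc |t| ^ (-(1 + θ)) * 4⁻¹ ≤ |t| ^ (-(1 + θ)) * 2 ^ (-(1 + θ)) := by gcongr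
          _ = (|t| * 2) ^ (-(1 + θ)) := (Real.mul_rpow ht0.le (by norm_num)).symm
          _ ≤ _ := Real.rpow_le_rpow_of_nonpos (by positivity) (by linarith) (by linarith)
      have e1 : (A - a) ^ (1 - θ) = (A - a) * (A - a) ^ (-θ) := by
        rw [sub_eq_add_neg 1 θ, Real.rpow_add hh, Real.rpow_one]
      have e2 : |t| ^ (1 - θ) = |t| ^ (-(1 + θ)) * t ^ 2 := by
        rw [ht2, ← Real.rpow_natCast |t| 2, ← Real.rpow_add ht0]
        congr 1
        push_cast
        ring
      calc |Real.cos (a * t) - Real.cos (A * t)| ≤ 2 * ((A - a) * |t|) ^ (1 - θ) :=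
            abs_cos_sub_cos_le_rpow h hθ hθ1 ht
        _ = (A - a) * (4 * (0 + 2 * (A - a) ^ (-θ)) * (|t| ^ (-(1 + θ)) * 4⁻¹)) * t ^ 2 := by
            rw [Real.mul_rpow hh.le ht0.le, e1, e2]
            ring
        _ ≤ _ := by gcongr
  rw [trapKernel, abs_mul, abs_div, abs_of_pos (by positivity : 0 < t ^ 2),
    abs_of_pos (by positivity : 0 < (fejerConst * (A - a))⁻¹)]
  refine (mul_le_mul_of_nonneg_left key (by positivity)).trans (le_of_eq ?_)
  field_simp

/-- With `a = log m` and `A = log (m + 1)`, the gap `A - a` is at least `1 / (m + 1)` and `A` grows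
slower than any power. -/
theorem exists_truncNorm_le {θ : ℝ} (hθ : 0 < θ) (hθ1 : θ ≤ 1) :
    ∃ C : ℝ, ∀ i : ℕ, truncNorm (i + 1) ≤ C * ((i + 1 : ℕ) : ℝ) ^ θ := by
  have hw : Integrable fun t : ℝ => (1 + |t|) ^ (-(1 + θ)) := by
    simpa using integrable_one_add_norm (E := ℝ) (μ := volume) (r := 1 + θ) (by simpa using hθ)
  set W := ∫ t : ℝ, (1 + |t|) ^ (-(1 + θ)) with hW
  have hW0 : 0 ≤ W := integral_nonneg fun t => by positivity
  have hc := fejerConst_pos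
  refine ⟨fejerConst⁻¹ * 4 * ((1 / θ + 2) * 2 ^ θ) * W, fun i => ?_⟩
  set a := Real.log ((i + 1 : ℕ) : ℝ) with ha
  set A := Real.log (((i + 1 : ℕ) : ℝ) + 1) with hA
  have hm : (0 : ℝ) < ((i + 1 : ℕ) : ℝ) := by positivity
  have hm1 : (1 : ℝ) ≤ ((i + 1 : ℕ) : ℝ) := by push_cast; linarith [i.cast_nonneg (α := ℝ)]
  set m := ((i + 1 : ℕ) : ℝ) with hmdef
  have ha0 : 0 ≤ a := Real.log_nonneg hm1
  have haA : a < A := Real.log_lt_log hm (by linarith)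
  have h1 : truncNorm (i + 1) ≤
      ∫ t : ℝ, fejerConst⁻¹ * 4 * (A + 2 * (A - a) ^ (-θ)) * (1 + |t|) ^ (-(1 + θ)) :=
    integral_mono (integrable_trapKernel _ _).norm (hw.const_mul _)
      fun t => abs_trapKernel_le ha0 haA hθ hθ1
  rw [integral_const_mul, ← hW] at h1
  refine h1.trans ?_
  have h2 : A ≤ (1 / θ) * (m + 1) ^ θ := by
    have := Real.log_le_rpow_div (by linarith : 0 ≤ m + 1) hθ
    rw [hA]; linarith [this, div_eq_mul_one_div ((m + 1) ^ θ) θ]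
  have h3 : (m + 1)⁻¹ ≤ A - a := by
    rw [hA, ha, ← Real.log_div (by linarith) hm.ne']
    refine le_trans (le_of_eq ?_) (Real.one_sub_inv_le_log_of_pos (by positivity))
    field_simp
    ring
  have h4 : (A - a) ^ (-θ) ≤ (m + 1) ^ θ := by
    refine (Real.rpow_le_rpow_of_nonpos (by positivity) h3 (by linarith)).trans (le_of_eq ?_)
    rw [Real.inv_rpow (by positivity), Real.rpow_neg (by positivity), inv_inv]
  have h5 : (m + 1) ^ θ ≤ 2 ^ θ * m ^ θ := by
    rw [← Real.mul_rpow (by norm_num) hm.le]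
    exact Real.rpow_le_rpow (by positivity) (by linarith) hθ.le
  calc fejerConst⁻¹ * 4 * (A + 2 * (A - a) ^ (-θ)) * W
      ≤ fejerConst⁻¹ * 4 * ((1 / θ + 2) * (2 ^ θ * m ^ θ)) * W := by
        gcongr
        calc A + 2 * (A - a) ^ (-θ) ≤ (1 / θ) * (m + 1) ^ θ + 2 * (m + 1) ^ θ := by gcongr
          _ = (1 / θ + 2) * (m + 1) ^ θ := by ring
          _ ≤ _ := by gcongr
    _ = _ := by ring

/-! ### Bohr's inequality for partial sums. -/

theorem add_mul_I_mem_Omega {δ : ℝ} {z : ℂ} (hz : z ∈ Omega δ) (t : ℝ) :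
    z + t * Complex.I ∈ Omega δ := by
  change δ < (z + t * Complex.I).re
  have hz' : δ < z.re := hz
  simpa using hz'

theorem continuous_vertical {δ : ℝ} {F : ℂ → ℂ} (hF : ContinuousOn F (Omega δ)) {z : ℂ}
    (hz : z ∈ Omega δ) : Continuous fun t : ℝ => F (z + t * Complex.I) :=
  hF.comp_continuous (by fun_prop) (add_mul_I_mem_Omega hz)

/-- Averaging the vertical translates of a bounded holomorphic function on a half-plane
against an integrable kernel gives a holomorphic function. -/
theorem differentiableOn_integral_vertical {δ B : ℝ} {F : ℂ → ℂ} {k : ℝ → ℝ}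
    (hF : DifferentiableOn ℂ F (Omega δ)) (hB : ∀ s ∈ Omega δ, ‖F s‖ ≤ B) (hk : Integrable k) :
    DifferentiableOn ℂ (fun z => ∫ t : ℝ, F (z + t * Complex.I) * (k t : ℂ)) (Omega δ) := by
  intro z hz
  have hz' : δ < z.re := hz
  set r := (z.re - δ) / 3 with hr
  have hr0 : 0 < r := by rw [hr]; linarith
  have hkc : Integrable fun t => (k t : ℂ) := hk.ofReal
  have hmem : ∀ y ∈ Metric.ball z r, y ∈ Omega (δ + r) := by
    intro y hy
    have h1 : |(y - z).re| < r :=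
      (Complex.abs_re_le_norm _).trans_lt (by simpa [dist_eq_norm] using hy)
    have h2 := (abs_lt.1 h1).1
    rw [Complex.sub_re] at h2
    change δ + r < y.re
    linarith
  have hsub : Omega (δ + r) ⊆ Omega δ := fun y hy =>
    lt_trans (by linarith) (show δ + r < y.re from hy)
  -- Cauchy's estimate on discs of radius `r`. The bound is invariant under vertical translation,
  -- hence uniform in `t`.
  have hderiv : ∀ y ∈ Omega (δ + r), ‖deriv F y‖ ≤ B / r := by
    intro y hy
    have hy' : δ + r < y.re := hy
    have hball : ∀ x ∈ Metric.closedBall y r, x ∈ Omega δ := by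
      intro x hx
      have h1 : |(x - y).re| ≤ r :=
        (Complex.abs_re_le_norm _).trans (by simpa [dist_eq_norm] using hx)
      have h2 := (abs_le.1 h1).1
      rw [Complex.sub_re] at h2
      change δ < x.re
      linarith
    refine Complex.norm_deriv_le_of_forall_mem_sphere_norm_le hr0 ?_
      fun x hx => hB x (hball x (Metric.sphere_subset_closedBall hx))
    refine DifferentiableOn.diffContOnCl (hF.mono fun x hx => hball x ?_)
    exact Metric.closure_ball_subset_closedBall hx
  have hmeas : ∀ y ∈ Omega δ, AEStronglyMeasurable
      (fun t : ℝ => F (y + t * Complex.I) * (k t : ℂ)) volume := fun y hy =>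
    (continuous_vertical hF.continuousOn hy).aestronglyMeasurable.mul hkc.aestronglyMeasurable
  have hres := hasDerivAt_integral_of_dominated_loc_of_deriv_le (μ := volume)
    (F := fun (y : ℂ) (t : ℝ) => F (y + t * Complex.I) * (k t : ℂ))
    (F' := fun (y : ℂ) (t : ℝ) => deriv F (y + t * Complex.I) * (k t : ℂ))
    (bound := fun t => B / r * ‖k t‖) (Metric.ball_mem_nhds z hr0)
    (by
      filter_upwards [(isOpen_Omega δ).mem_nhds hz] with y hy using hmeas y hy)
    (hkc.bdd_mul (c := B) (continuous_vertical hF.continuousOn hz).aestronglyMeasurable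
      (ae_of_all _ fun t => hB _ (add_mul_I_mem_Omega hz t)))
    ((continuous_vertical (hF.deriv (isOpen_Omega δ)).continuousOn hz).aestronglyMeasurable.mul
      hkc.aestronglyMeasurable)
    (ae_of_all _ fun t y hy => by
      rw [norm_mul, Complex.norm_real]
      exact mul_le_mul_of_nonneg_right (hderiv _ (add_mul_I_mem_Omega (hmem y hy) t))
        (norm_nonneg _))
    (hk.norm.const_mul _)
    (ae_of_all _ fun t y hy => by
      have hy' := add_mul_I_mem_Omega (hsub (hmem y hy)) t
      have h1 := (hF.differentiableAt ((isOpen_Omega δ).mem_nhds hy')).hasDerivAt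
      exact (h1.comp_add_const y (t * Complex.I)).mul_const _)
  exact hres.2.differentiableAt.differentiableWithinAt

theorem differentiable_rangeSum (c : ℕ → ℂ) (m : ℕ) :
    Differentiable ℂ fun s => rangeSum c s m := by
  unfold rangeSum
  refine Differentiable.fun_sum fun i _ => ?_
  have h1 : ((i + 1 : ℕ) : ℂ) ≠ 0 := Nat.cast_ne_zero.2 (by omega)
  exact (differentiable_id.neg.const_cpow (Or.inl h1)).const_mul _

/-- A vertical shift modulates the term of index `n` with frequency `log n`, so averaging against a
kernel samples its Fourier transform at `log n`. -/
theorem natCast_cpow_vertical (i : ℕ) (z : ℂ) (t : ℝ) :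
    ((i + 1 : ℕ) : ℂ) ^ (-(z + t * Complex.I)) = ((i + 1 : ℕ) : ℂ) ^ (-z) *
      Complex.exp (-((Real.log ((i + 1 : ℕ) : ℝ) : ℂ) * t * Complex.I)) := by
  have h1 : ((i + 1 : ℕ) : ℂ) ≠ 0 := Nat.cast_ne_zero.2 (by omega)
  rw [neg_add, Complex.cpow_add _ _ h1]
  congr 1
  rw [Complex.cpow_def_of_ne_zero h1, Complex.natCast_log]
  ring_nf

/-- In the half-plane of absolute convergence the kernel cuts the series off after `m` terms. -/
theorem integral_vertical_trapKernel_eq_rangeSum {c : ℕ → ℂ} {F : ℂ → ℂ} {z : ℂ} {m : ℕ}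
    (hm : 1 ≤ m) (hc : Summable fun i : ℕ => ‖c i‖ * ((i + 1 : ℕ) : ℝ) ^ (-z.re))
    (hF : ∀ t : ℝ, Tendsto (rangeSum c (z + t * Complex.I)) atTop (𝓝 (F (z + t * Complex.I)))) :
    ∫ t : ℝ, F (z + t * Complex.I) * (trapKernel (Real.log m) (Real.log (m + 1)) t : ℂ)
      = rangeSum c z m := by
  set a := Real.log m with ha
  set A := Real.log (m + 1) with hA
  have hm0 : (0 : ℝ) < m := by exact_mod_cast hm
  have ha0 : 0 ≤ a := Real.log_nonneg (by exact_mod_cast hm)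
  have haA : a < A := Real.log_lt_log hm0 (by linarith)
  have hki : Integrable fun t => (trapKernel a A t : ℂ) := (integrable_trapKernel a A).ofReal
  set term : ℕ → ℝ → ℂ := fun i t => c i * ((i + 1 : ℕ) : ℂ) ^ (-(z + t * Complex.I)) with hterm
  have hnorm : ∀ i t, ‖term i t‖ = ‖c i‖ * ((i + 1 : ℕ) : ℝ) ^ (-z.re) := by
    intro i t
    rw [hterm]
    simp only
    rw [norm_mul, Complex.norm_natCast_cpow_of_pos i.succ_pos]
    simp
  have hcont : ∀ i, Continuous (term i) := by
    intro i
    have h1 : ((i + 1 : ℕ) : ℂ) ≠ 0 := Nat.cast_ne_zero.2 (by omega)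
    exact continuous_const.mul (Continuous.const_cpow (by fun_prop) (Or.inl h1))
  have hsumF : ∀ t : ℝ, F (z + t * Complex.I) = ∑' i, term i t := by
    intro t
    refine tendsto_nhds_unique (hF t) ?_
    have : Summable fun i => term i t := Summable.of_norm (by simpa only [hnorm] using hc)
    exact this.hasSum.tendsto_sum_nat
  have hint : ∀ i, Integrable fun t => term i t * (trapKernel a A t : ℂ) := fun i =>
    hki.bdd_mul (c := ‖c i‖ * ((i + 1 : ℕ) : ℝ) ^ (-z.re)) (hcont i).aestronglyMeasurable
      (ae_of_all _ fun t => (hnorm i t).le)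
  have hswap := hasSum_integral_of_summable_integral_norm hint (by
    simp only [norm_mul, hnorm, integral_const_mul]
    exact hc.mul_right _)
  have hval : ∀ i, ∫ t, term i t * (trapKernel a A t : ℂ)
      = if i ∈ Finset.range m then c i * ((i + 1 : ℕ) : ℂ) ^ (-z) else 0 := by
    intro i
    have e : ∀ t, term i t * (trapKernel a A t : ℂ) = c i * ((i + 1 : ℕ) : ℂ) ^ (-z) *
        (Complex.exp (-((Real.log ((i + 1 : ℕ) : ℝ) : ℂ) * t * Complex.I)) *
          (trapKernel a A t : ℂ)) := by
      intro t
      rw [hterm]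
      simp only
      rw [natCast_cpow_vertical]
      ring
    rw [integral_congr_ae (ae_of_all _ e), integral_const_mul, integral_cexp_mul_trapKernel]
    have hi0 : 0 ≤ Real.log ((i + 1 : ℕ) : ℝ) := Real.log_natCast_nonneg _
    -- No integer lies strictly between `m` and `m + 1`, so the sloping part of the trapezoid is
    -- never sampled.
    split_ifs with h
    · have h' : i + 1 ≤ m := Finset.mem_range.1 h
      rw [integral_cos_mul_trapKernel_of_le haA hi0
        (Real.log_le_log (by positivity) (by exact_mod_cast h'))]
      simp
    · have h' : m + 1 ≤ i + 1 := by
        rw [Finset.mem_range] at h; omega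
      rw [integral_cos_mul_trapKernel_of_ge ha0 haA
        (Real.log_le_log (by positivity) (by exact_mod_cast h'))]
      simp
  simp only [hval] at hswap
  have h1 : ∫ t : ℝ, F (z + t * Complex.I) * (trapKernel a A t : ℂ)
      = ∫ t : ℝ, ∑' i, term i t * (trapKernel a A t : ℂ) := by
    refine integral_congr_ae (ae_of_all _ fun t => ?_)
    simp only
    rw [hsumF t, tsum_mul_right]
  rw [h1, rangeSum]
  refine hswap.unique ?_
  have := hasSum_sum_of_ne_finset_zero (L := SummationFilter.unconditional ℕ)
    (s := Finset.range m)
    (f := fun i => if i ∈ Finset.range m then c i * ((i + 1 : ℕ) : ℂ) ^ (-z) else 0)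
    (fun i hi => by rw [if_neg hi])
  rwa [Finset.sum_congr rfl (fun i hi => if_pos hi)] at this

/-- Bohr's inequality: the partial sums of a Dirichlet series whose sum is bounded by `B` on a
half-plane are bounded there by `B` times a quantity that depends only on the number of terms. -/
theorem norm_rangeSum_le_mul_truncNorm {c : ℕ → ℂ} {F : ℂ → ℂ} {δ B σ : ℝ}
    (hc : Summable fun i : ℕ => ‖c i‖ * ((i + 1 : ℕ) : ℝ) ^ (-σ))
    (hF : ∀ s ∈ Omega δ, Tendsto (rangeSum c s) atTop (𝓝 (F s)))
    (hB : ∀ s ∈ Omega δ, ‖F s‖ ≤ B) {s : ℂ} (hs : s ∈ Omega δ) {m : ℕ} (hm : 1 ≤ m) :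
    ‖rangeSum c s m‖ ≤ B * truncNorm m := by
  have hk := integrable_trapKernel (Real.log m) (Real.log (m + 1))
  have hG := differentiableOn_integral_vertical (differentiableOn_of_tendsto_rangeSum hF) hB hk
  set G : ℂ → ℂ := fun z => ∫ t : ℝ, F (z + t * Complex.I) *
    (trapKernel (Real.log m) (Real.log (m + 1)) t : ℂ) with hGdef
  set ρ := max σ δ with hρ
  have hfar : ∀ z ∈ Omega ρ, G z = rangeSum c z m := by
    intro z hz
    have hz' : ρ < z.re := hz
    have hzδ : z ∈ Omega δ := lt_of_le_of_lt (le_max_right _ _) hz'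
    refine integral_vertical_trapKernel_eq_rangeSum hm ?_
      fun t => hF _ (add_mul_I_mem_Omega hzδ t)
    refine Summable.of_nonneg_of_le (fun i => by positivity) (fun i => ?_) hc
    refine mul_le_mul_of_nonneg_left ?_ (norm_nonneg _)
    refine Real.rpow_le_rpow_of_exponent_le
      (by push_cast; linarith [i.cast_nonneg (α := ℝ)]) (neg_le_neg ?_)
    exact (le_max_left _ _).trans hz'.le
  have hz₀ : ((ρ + 1 : ℝ) : ℂ) ∈ Omega ρ := by
    change ρ < ((ρ + 1 : ℝ) : ℂ).re
    rw [Complex.ofReal_re]; linarith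
  have hz₀δ : ((ρ + 1 : ℝ) : ℂ) ∈ Omega δ :=
    lt_of_le_of_lt (le_max_right σ δ) (show ρ < ((ρ + 1 : ℝ) : ℂ).re from hz₀)
  have hconv : IsPreconnected (Omega δ) := (convex_halfSpace_re_gt δ).isPreconnected
  -- The average equals the partial sum where the series converges absolutely; the identity theorem
  -- carries this to all of `Omega δ`, where absolute convergence may fail.
  have heq := AnalyticOnNhd.eqOn_of_preconnected_of_eventuallyEq
    (hG.analyticOnNhd (isOpen_Omega δ))
    ((differentiable_rangeSum c m).differentiableOn.analyticOnNhd (isOpen_Omega δ)) hconv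
    hz₀δ
    (by filter_upwards [(isOpen_Omega ρ).mem_nhds hz₀] with z hz using hfar z hz)
  have h1 : G s = rangeSum c s m := heq hs
  rw [← h1, hGdef, truncNorm, ← integral_const_mul]
  refine norm_integral_le_of_norm_le (hk.norm.const_mul B) (ae_of_all _ fun t => ?_)
  rw [norm_mul, Complex.norm_real]
  exact mul_le_mul_of_nonneg_right (hB _ (add_mul_I_mem_Omega hs t)) (norm_nonneg _)

/-! ### Reindexing by natural numbers, and absolute convergence. -/

theorem partialSum_eq_rangeSum (a : ℕ+ → ℂ) (s : ℂ) (M : ℕ+) :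
    partialSum a s M = rangeSum (fun i => a i.succPNat) s M := by
  unfold partialSum rangeSum
  refine Finset.sum_nbij' PNat.natPred Nat.succPNat ?_ ?_ ?_ ?_ ?_
  · intro n hn
    have h1 : (n : ℕ) ≤ M := (Finset.mem_Icc.1 hn).2
    have h2 := n.natPred_add_one
    exact Finset.mem_range.2 (by omega)
  · intro i hi
    refine Finset.mem_Icc.2 ⟨one_le, ?_⟩
    rw [← PNat.coe_le_coe, Nat.succPNat_coe]
    exact Finset.mem_range.1 hi
  · intro n _
    exact PNat.succPNat_natPred n
  · intro i _
    exact Nat.natPred_succPNat i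
  · intro n _
    simp

theorem tendsto_partialSum_iff {a : ℕ+ → ℂ} {s z : ℂ} :
    Tendsto (partialSum a s) atTop (𝓝 z) ↔
      Tendsto (rangeSum (fun i => a i.succPNat) s) atTop (𝓝 z) := by
  constructor
  · intro h
    have h1 : Tendsto Nat.succPNat atTop atTop :=
      tendsto_atTop_mono (f := fun n : ℕ => n.succPNat) (fun _ => le_rfl)
        (Monotone.tendsto_atTop_atTop Nat.succPNat_mono fun b => ⟨b, by
          rw [← PNat.coe_le_coe, Nat.succPNat_coe]; omega⟩)
    refine (tendsto_add_atTop_iff_nat 1).1 ((h.comp h1).congr fun m => ?_)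
    simp [partialSum_eq_rangeSum]
  · intro h
    have h1 : Tendsto (fun n : ℕ+ => (n : ℕ)) atTop atTop :=
      Monotone.tendsto_atTop_atTop (fun _ _ h => h) fun b => ⟨b.succPNat, by simp⟩
    exact (h.comp h1).congr fun M => (partialSum_eq_rangeSum a s M).symm

theorem Converges.tendsto_rangeSum {a : ℕ+ → ℂ} {s : ℂ} (h : Converges a s) :
    Tendsto (rangeSum (fun i => a i.succPNat) s) atTop (𝓝 (seriesSum a s)) := by
  obtain ⟨z, hz⟩ := h
  rw [seriesSum, hz.limUnder_eq]
  exact tendsto_partialSum_iff.1 hz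

theorem summable_succPNat_iff {f : ℕ+ → ℝ} :
    Summable (fun i : ℕ => f i.succPNat) ↔ Summable f :=
  Equiv.pnatEquivNat.symm.summable_iff (f := f)

theorem converges_of_summable {a : ℕ+ → ℂ} {s : ℂ}
    (h : Summable fun n : ℕ+ => ‖a n‖ * ((n : ℕ) : ℝ) ^ (-s.re)) : Converges a s := by
  have h1 : Summable fun i : ℕ => a i.succPNat * ((i + 1 : ℕ) : ℂ) ^ (-s) := by
    refine Summable.of_norm ((summable_succPNat_iff.2 h).congr fun i => ?_)
    rw [norm_mul, Complex.norm_natCast_cpow_of_pos i.succ_pos]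
    simp
  exact ⟨_, tendsto_partialSum_iff.2 h1.hasSum.tendsto_sum_nat⟩

/-- The Cauchy–Schwarz criterion for absolute convergence of an element of the weighted space
with coefficients supported in `S`. -/
theorem HSpace.summable_norm_coeff {w : Weight} (f : HSpace w) {S : Set ℕ+} {σ : ℝ}
    (hf : ∀ n ∉ S, f.coeff n = 0)
    (hS : Summable fun n : S => (w (n : ℕ+) : ℝ)⁻¹ * (((n : ℕ+) : ℕ) : ℝ) ^ (-2 * σ)) :
    Summable fun n : ℕ+ => ‖f.coeff n‖ * ((n : ℕ) : ℝ) ^ (-σ) := by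
  have h1 : Summable (S.indicator fun n : ℕ+ => (w n : ℝ)⁻¹ * ((n : ℕ) : ℝ) ^ (-2 * σ)) :=
    summable_subtype_iff_indicator.1 hS
  have h2 : Summable fun n : ℕ+ => ‖f.coeff n‖ ^ 2 * (w n : ℝ) := f.2
  refine Summable.of_nonneg_of_le (fun n => by positivity) (fun n => ?_) (h2.add h1)
  by_cases hn : n ∈ S
  · have hw : (0 : ℝ) < w n := (w n).2
    have hn0 : (0 : ℝ) < ((n : ℕ) : ℝ) := by exact_mod_cast n.pos
    rw [Set.indicator_of_mem hn]
    have e : ((n : ℕ) : ℝ) ^ (-2 * σ) = (((n : ℕ) : ℝ) ^ (-σ)) ^ 2 := by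
      rw [← Real.rpow_natCast, ← Real.rpow_mul hn0.le]
      congr 1
      push_cast
      ring
    rw [e]
    set x := ‖f.coeff n‖
    set y := ((n : ℕ) : ℝ) ^ (-σ)
    -- A sum of squares that certifies `x * y ≤ x ^ 2 * w + y ^ 2 / w`.
    have h3 : 0 ≤ (w n : ℝ)⁻¹ * ((x * w n - y) ^ 2 + (x * w n) ^ 2 + y ^ 2) := by positivity
    have h4 : (w n : ℝ)⁻¹ * ((x * w n - y) ^ 2 + (x * w n) ^ 2 + y ^ 2)
        = 2 * (x ^ 2 * w n + (w n : ℝ)⁻¹ * y ^ 2 - x * y) := by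
      field_simp
      ring
    linarith
  · rw [hf n hn, Set.indicator_of_notMem hn]
    simp

/-! ### The projections as restrictions of coefficients. -/

theorem inner_monomial {w : Weight} (n : ℕ+) (f : HSpace w) :
    inner ℂ (monomial w n) f = f.coeff n * ((w n : ℝ) : ℂ) := by
  change ∑' m, (starRingEnd ℂ) ((monomial w n).coeff m) * f.coeff m * ((w m : ℝ) : ℂ) = _
  rw [tsum_eq_single n]
  · simp [monomial, HSpace.coeff]
  · intro m hm
    simp [monomial, HSpace.coeff, hm]

theorem mem_orthogonal_HSub {w : Weight} {N : ℕ} {f : HSpace w} :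
    f ∈ (HSub w N)ᗮ ↔ ∀ n ∈ words N, f.coeff n = 0 := by
  have hw : ∀ n, ((w n : ℝ) : ℂ) ≠ 0 := fun n => Complex.ofReal_ne_zero.2 (w n).2.ne'
  rw [HSub, Submodule.orthogonal_closure, Submodule.mem_orthogonal]
  constructor
  · intro h n hn
    have h1 := h _ (Submodule.subset_span ⟨n, hn, rfl⟩)
    rw [inner_monomial] at h1
    exact (mul_eq_zero.1 h1).resolve_right (hw n)
  · intro h u hu
    induction hu using Submodule.span_induction with
    | mem x hx =>
      obtain ⟨n, hn, rfl⟩ := hx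
      rw [inner_monomial, h n hn, zero_mul]
    | zero => exact inner_zero_left _
    | add x y _ _ hx hy => rw [inner_add_left, hx, hy, add_zero]
    | smul c x _ hx => rw [inner_smul_left, hx, mul_zero]

open Classical in
/-- The element obtained by keeping only the coefficients with index in `S`. -/
noncomputable def HSpace.restrict {w : Weight} (f : HSpace w) (S : Set ℕ+) : HSpace w :=
  ⟨fun n => if n ∈ S then f.coeff n else 0, by
    have h : Summable fun n : ℕ+ => ‖f.coeff n‖ ^ 2 * (w n : ℝ) := f.2
    refine Summable.of_nonneg_of_le
      (fun n => mul_nonneg (sq_nonneg _) (le_of_lt (w n).2)) (fun n => ?_) h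
    have hw : (0 : ℝ) < w n := (w n).2
    dsimp only
    split_ifs
    · exact le_rfl
    · rw [norm_zero, zero_pow two_ne_zero, zero_mul]
      positivity⟩

theorem HSpace.coeff_sub {w : Weight} (f g : HSpace w) (n : ℕ+) :
    (f - g).coeff n = f.coeff n - g.coeff n := rfl

open Classical in
theorem HSpace.coeff_restrict {w : Weight} (f : HSpace w) (S : Set ℕ+) (n : ℕ+) :
    (f.restrict S).coeff n = if n ∈ S then f.coeff n else 0 := rfl

/-- The closed subspace `HSub w N` is its own double orthogonal complement, so membership too is
tested on coefficients through `mem_orthogonal_HSub`. -/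
theorem proj_eq_restrict {w : Weight} (N : ℕ) (f : HSpace w) :
    proj w N f = f.restrict (words N) := by
  refine Submodule.eq_starProjection_of_mem_orthogonal ?_ ?_
  · have h1 : (HSub w N)ᗮᗮ = HSub w N := by
      rw [Submodule.orthogonal_orthogonal]
    rw [← h1, Submodule.mem_orthogonal]
    intro g hg
    rw [mem_orthogonal_HSub] at hg
    change ∑' n, (starRingEnd ℂ) (g.coeff n) * (f.restrict (words N)).coeff n * ((w n : ℝ) : ℂ) = 0
    refine (tsum_congr fun n => ?_).trans tsum_zero
    by_cases hn : n ∈ words N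
    · simp [hg n hn]
    · simp [HSpace.coeff_restrict, hn]
  · rw [mem_orthogonal_HSub]
    intro n hn
    simp [HSpace.coeff_sub, HSpace.coeff_restrict, hn]

theorem proj_coeff_of_mem {w : Weight} {N : ℕ} {n : ℕ+} (hn : n ∈ words N) (f : HSpace w) :
    (proj w N f).coeff n = f.coeff n := by
  rw [proj_eq_restrict, HSpace.coeff_restrict]
  exact if_pos hn

theorem proj_coeff_of_notMem {w : Weight} {N : ℕ} {n : ℕ+} (hn : n ∉ words N) (f : HSpace w) :
    (proj w N f).coeff n = 0 := by
  rw [proj_eq_restrict, HSpace.coeff_restrict]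
  exact if_neg hn

theorem eventually_mem_words (n : ℕ+) : ∀ᶠ N in atTop, n ∈ words N := by
  obtain ⟨n, hn⟩ := n
  induction n using Nat.recOnMul with
  | zero => exact absurd hn (lt_irrefl 0)
  | one => exact Eventually.of_forall fun N => one_mem _
  | prime p hp =>
    -- Primes are numbered from 0, so `p` has index `Nat.count Nat.Prime p`.
    filter_upwards [eventually_gt_atTop (Nat.count Nat.Prime p)] with N hN
    exact Submonoid.subset_closure ⟨_, hN, (Nat.nth_count hp).symm⟩
  | mul a b iha ihb =>
    have ha : 0 < a := Nat.pos_of_mul_pos_right hn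
    have hb : 0 < b := Nat.pos_of_mul_pos_left hn
    filter_upwards [iha ha, ihb hb] with N h1 h2
    exact mul_mem h1 h2

theorem eventually_rangeSum_proj_eq {w : Weight} (f : HSpace w) (s : ℂ) (m : ℕ) :
    ∀ᶠ N in atTop, rangeSum (fun i => (proj w N f).coeff i.succPNat) s m
      = rangeSum (fun i => f.coeff i.succPNat) s m := by
  have h : ∀ᶠ N in atTop, ∀ i ∈ Finset.range m, i.succPNat ∈ words N :=
    (eventually_all_finset _).2 fun i _ => eventually_mem_words _
  filter_upwards [h] with N hN
  exact Finset.sum_congr rfl fun i hi => by simp only [proj_coeff_of_mem (hN i hi)]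

/-! ### Passage to the limit in `N`. -/

/-- If the projections of `f` have sums bounded by `B` on a half-plane, uniformly in `N`, then
the series of `f` converges there, and its sum is the limit of the sums of the projections. -/
theorem tendsto_seriesSum_proj {w : Weight} {f : HSpace w} {δ B σ : ℝ}
    (hf : Summable fun n : ℕ+ => ‖f.coeff n‖ * ((n : ℕ) : ℝ) ^ (-σ))
    (h : ∀ N : ℕ, 1 ≤ N → ∀ s ∈ Omega δ, Converges (proj w N f).coeff s ∧
      ‖seriesSum (proj w N f).coeff s‖ ≤ B) {s : ℂ} (hs : s ∈ Omega δ) :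
    Converges f.coeff s ∧
      Tendsto (fun N => seriesSum (proj w N f).coeff s) atTop (𝓝 (seriesSum f.coeff s)) := by
  have hs' : δ < s.re := hs
  -- Half the distance to the boundary goes into `u`; the growth exponent `θ` is kept below `u.re`,
  -- and at most 1 for `exists_truncNorm_le`.
  set u : ℂ := (((s.re - δ) / 2 : ℝ) : ℂ) with hu
  have hure : u.re = (s.re - δ) / 2 := Complex.ofReal_re _
  set s₀ : ℂ := s - u with hs₀
  have hs₀mem : s₀ ∈ Omega δ := by
    change δ < (s - u).re
    rw [Complex.sub_re, hure]; linarith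
  set θ : ℝ := min ((s.re - δ) / 4) 1 with hθ
  have hθ0 : 0 < θ := lt_min (by linarith) one_pos
  have hθu : θ < u.re := by
    rw [hure]
    exact (min_le_left _ _).trans_lt (by linarith)
  have hB0 : 0 ≤ B := (norm_nonneg _).trans (h 1 le_rfl s hs).2
  obtain ⟨C, hC⟩ := exists_truncNorm_le hθ0 (min_le_right _ _)
  have hproj : ∀ N : ℕ, 1 ≤ N → ∀ i : ℕ,
      ‖rangeSum (fun i => (proj w N f).coeff i.succPNat) s₀ (i + 1)‖
        ≤ B * C * ((i + 1 : ℕ) : ℝ) ^ θ := by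
    intro N hN i
    rw [mul_assoc]
    refine (norm_rangeSum_le_mul_truncNorm (σ := σ) ?_
      (fun z hz => (h N hN z hz).1.tendsto_rangeSum) (fun z hz => (h N hN z hz).2)
      hs₀mem i.succ_pos).trans (mul_le_mul_of_nonneg_left (hC i) hB0)
    refine Summable.of_nonneg_of_le (fun i => by positivity) (fun i => ?_)
      (summable_succPNat_iff.2 hf)
    refine mul_le_mul_of_nonneg_right ?_ (by positivity)
    by_cases hn : i.succPNat ∈ words N
    · rw [proj_coeff_of_mem hn]
    · rw [proj_coeff_of_notMem hn]
      simp
  -- The choice of `N` depends on `i`, but the bound does not depend on `N`.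
  have hlim : ∀ i : ℕ, ‖rangeSum (fun i => f.coeff i.succPNat) s₀ (i + 1)‖
      ≤ B * C * ((i + 1 : ℕ) : ℝ) ^ θ := by
    intro i
    obtain ⟨N, hN, hN1⟩ := ((eventually_rangeSum_proj_eq f s₀ (i + 1)).and (eventually_ge_atTop 1)).exists
    rw [← hN]
    exact hproj N hN1 i
  have hsu : s₀ + u = s := sub_add_cancel s u
  have h1 := tendsto_rangeSum_add hθ0.le hlim hθu
  rw [hsu] at h1
  have h2 := tendsto_partialSum_iff.2 h1
  refine ⟨⟨_, h2⟩, ?_⟩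
  rw [seriesSum, h2.limUnder_eq]
  have h3 : ∀ᶠ N in atTop, ∑' i, abelTerm (fun i => (proj w N f).coeff i.succPNat) s₀ u i
      = seriesSum (proj w N f).coeff s := by
    filter_upwards [eventually_ge_atTop 1] with N hN
    have h4 := tendsto_rangeSum_add hθ0.le (hproj N hN) hθu
    rw [hsu] at h4
    exact tendsto_nhds_unique h4 (h N hN s hs).1.tendsto_rangeSum
  refine Tendsto.congr' h3 ?_
  -- Each summand is eventually constant in `N`.
  refine tendsto_tsum_of_dominated_convergence
    ((summable_succ_rpow (by linarith : θ - u.re - 1 < -1)).mul_left (B * C * ‖u‖))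
    (fun i => ?_) ?_
  · refine tendsto_const_nhds.congr' ?_
    filter_upwards [eventually_rangeSum_proj_eq f s₀ (i + 1)] with N hN
    rw [abelTerm, abelTerm, hN]
  · filter_upwards [eventually_ge_atTop 1] with N hN i
    exact norm_abelTerm_le (hproj N hN) (hθ0.trans hθu) i

end DirichletHilbert

/-! ### The theorem. -/

theorem mainTheorem7 (w : DirichletHilbert.Weight) (Δ Δ' : ℝ)
    (hΔ' : ∀ σ : ℝ, Δ' < σ →
      Summable fun n : ℕ+ => (w n : ℝ)⁻¹ * ((n : ℕ) : ℝ) ^ (-2 * σ))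
    (φ : ℂ → ℂ) (hφ : DirichletHilbert.IsMultiplier w Δ' φ) :
    -- the Dirichlet series of the multiplier represents it on the initial half-plane
    (∀ s ∈ DirichletHilbert.Omega Δ',
      DirichletHilbert.Converges hφ.series.coeff s ∧
        DirichletHilbert.seriesSum hφ.series.coeff s = φ s) ∧
    -- uniformly bounded projections
    (∀ B : ℝ,
      (∀ N : ℕ, 1 ≤ N → ∀ s ∈ DirichletHilbert.Omega Δ,
        DirichletHilbert.Converges (DirichletHilbert.proj w N hφ.series).coeff s ∧
          ‖DirichletHilbert.seriesSum (DirichletHilbert.proj w N hφ.series).coeff s‖ ≤ B) →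
      (∃ N : ℕ → ℕ, StrictMono N ∧ (∀ j, 1 ≤ N j) ∧
        ∀ s ∈ DirichletHilbert.Omega Δ,
          Filter.Tendsto
            (fun j => DirichletHilbert.seriesSum
              (DirichletHilbert.proj w (N j) hφ.series).coeff s)
            Filter.atTop (nhds (DirichletHilbert.seriesSum hφ.series.coeff s))) ∧
      (∀ s ∈ DirichletHilbert.Omega Δ, DirichletHilbert.Converges hφ.series.coeff s) ∧
      (∀ s ∈ DirichletHilbert.Omega Δ,
        ‖DirichletHilbert.seriesSum hφ.series.coeff s‖ ≤ B)) ∧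
    -- the convergence required of the projections is automatic under this condition
    ((∀ N : ℕ, 1 ≤ N → ∀ σ : ℝ, Δ < σ →
        Summable fun n : DirichletHilbert.words N =>
          (w (n : ℕ+) : ℝ)⁻¹ * (((n : ℕ+) : ℕ) : ℝ) ^ (-2 * σ)) →
      ∀ N : ℕ, 1 ≤ N → ∀ s ∈ DirichletHilbert.Omega Δ,
        DirichletHilbert.Converges (DirichletHilbert.proj w N hφ.series).coeff s) := by
  have hsum : ∀ σ : ℝ, Δ' < σ →
      Summable fun n : ℕ+ => ‖hφ.series.coeff n‖ * ((n : ℕ) : ℝ) ^ (-σ) := fun σ hσ =>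
    hφ.series.summable_norm_coeff (S := Set.univ) (fun n hn => absurd (Set.mem_univ n) hn)
      ((hΔ' σ hσ).subtype Set.univ)
  refine ⟨fun s hs => ⟨DirichletHilbert.converges_of_summable (hsum _ hs),
    hφ.seriesSum_series hs⟩, fun B h => ?_, fun h N hN s hs => ?_⟩
  · have key := fun s (hs : s ∈ DirichletHilbert.Omega Δ) =>
      -- Any abscissa beyond `Δ'` would do: absolute convergence is needed only somewhere, to start
      -- the identity theorem.
      DirichletHilbert.tendsto_seriesSum_proj (hsum (Δ' + 1) (lt_add_one Δ')) h hs
    -- The whole sequence converges; the shift only enforces `1 ≤ N j`.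
    refine ⟨⟨fun j => j + 1, strictMono_id.add_const 1, fun j => Nat.le_add_left 1 j,
      fun s hs => (key s hs).2.comp (tendsto_add_atTop_nat 1)⟩, fun s hs => (key s hs).1,
      fun s hs => ?_⟩
    refine le_of_tendsto (key s hs).2.norm ?_
    filter_upwards [eventually_ge_atTop 1] with N hN using (h N hN s hs).2
  · exact DirichletHilbert.converges_of_summable
      ((DirichletHilbert.proj _ N hφ.series).summable_norm_coeff (S := DirichletHilbert.words N)
        (fun n hn => DirichletHilbert.proj_coeff_of_notMem hn _) (h N hN s.re hs))
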